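/- Let $H$ be an infinite-dimensional separable complex Hilbert space with a Hilbert basis $\{|n\rangle\}_{n\in\mathbb Z}$. Let $U(H)$ be the Banach Lie group of unitary operators on $H$ (with the norm topology), and let $\mathfrak u(H)$ be its Lie algebra of bounded skew-hermitian operators. Let $L_1(H)$ be the space of trace-class operators, and $$\mathfrak b_1^+(H)=\{\alpha\in L_1(H):\ \alpha|n\rangle\in\overline{\operatorname{span}}\{|m\rangle: m\ge n\}\ \text{and}\ \langle n|\alpha|n\rangle\in\mathbb R\ \text{for all } n\in\mathbb Z\},$$ regarded as a subspace of the continuous dual $\mathfrak u(H)^*$ through $B\mapsto (A\mapsto \operatorname{Im}\operatorname{Tr}(AB))$. Definitions (all manifolds, bundles and sections are smooth, i.e. $C^\infty$, and real). A Banach bundle $\mathbb F$ over a Banach manifold $M$ is *in duality* with $TM$ if there are non-degenerate continuous bilinear pairings $\mathbb F_p\times T_pM\to\mathbb R$ depending smoothly on $p\in M$. Elements of $\mathbb F_p$ are then identified with elements of $T_p^*M$, and local sections of $\mathbb F$ with local 1-forms. A *Banach sub-Poisson manifold* $(M,\mathbb F,\pi)$ is a Banach manifold $M$ with a Banach bundle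 $\mathbb F$ in duality with $TM$ and a smooth field $\pi$ of continuous skew-symmetric bilinear forms on the fibers of $\mathbb F$ such that, for all closed local sections $\alpha,\beta,\gamma$ of $\mathbb F$, the form $d(\pi(\alpha,\beta))$ is a local section of $\mathbb F$ and $$\pi(\alpha,d(\pi(\beta,\gamma)))+\pi(\beta,d(\pi(\gamma,\alpha)))+\pi(\gamma,d(\pi(\alpha,\beta)))=0.$$ A smooth map $f:M_1\to M_2$ between Banach sub-Poisson manifolds $(M_i,\mathbb F_i,\pi_i)$ is a *Poisson map* if for every $p\in M_1$ the transpose $(T_pf)^*$ maps $(\mathbb F_2)_{f(p)}$ continuously into $(\mathbb F_1)_p$ and $(\pi_1)_p((T_pf)^*\alpha,(T_pf)^*\beta)=(\pi_2)_{f(p)}(\alpha,\beta)$ for all $\alpha,\beta\in(\mathbb F_2)_{f(p)}$. A *Banach Poisson–Lie group* is a Banach Lie group $G$ with a Banach sub-Poisson structure $(G,\mathbb F,\pi)$ such that the multiplication $G\times G\to G$ is a Poisson map, where $G\times G$ carries the product structure, with fibers $\mathbb F_g\oplus\mathbb F_h$ and tensor $\pi_g+\pi_h$ at $(g,h)$.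 **Corollary 3.3.** There is no Banach Poisson–Lie group structure $(U(H),\mathbb F,\pi)$ on $U(H)$ whose fiber at the identity $e$ is $\mathbb F_e=\mathfrak b_1^+(H)\subset\mathfrak u(H)^*$. -/

import Mathlib

open scoped Manifold ContDiff
open Bundle

noncomputable section

/-! ### The unitary group of a unital C*-algebra as a Banach Lie group -/

/-- The real Banach space of skew-adjoint elements of a unital C*-algebra. For the algebra of
bounded operators on a Hilbert space `H` this is `u(H)`; it is the model space of the unitary
group. -/
abbrev SkewElt (A : Type*) [CStarAlgebra A] : Submodule ℝ A := skewAdjoint.submodule ℝ A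

instance {A : Type*} [CStarAlgebra A] : CompleteSpace (SkewElt A) := by
  have h : IsClosed ((SkewElt A : Submodule ℝ A) : Set A) :=
    isClosed_eq (continuous_star (R := A)) continuous_neg
  exact h.completeSpace_coe

namespace UnitaryManifold

section
variable {A : Type*} [CStarAlgebra A]

theorem isUnit_one_sub_half (a : SkewElt A) : IsUnit (1 - (1 / 2 : ℝ) • (a : A)) := by
  have hs : star (a : A) = -(a : A) := a.2
  set x : A := (1 / 2 : ℝ) • (a : A) with hx
  have hsx : star x = -x := by simp [hx, hs]
  have h1 : IsSelfAdjoint (Complex.I • x) := by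
    rw [isSelfAdjoint_iff, star_smul, hsx]; simp
  by_contra hu
  have h2 : (1 : ℂ) ∈ spectrum ℂ x := by
    rw [spectrum.mem_iff, map_one]; exact hu
  have h3 : Complex.I • (1 : ℂ) ∈ spectrum ℂ (Complex.I • x) := by
    have := spectrum.smul_mem_smul_iff (R := ℂ) (a := x) (s := (1 : ℂ))
      (r := Units.mk0 Complex.I Complex.I_ne_zero)
    exact this.2 h2
  simpa using h1.im_eq_zero_of_mem_spectrum h3

/-- The (rescaled) Cayley transform `a ↦ (1 + a/2)(1 - a/2)⁻¹ = 2(1 - a/2)⁻¹ - 1`. It maps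
skew-adjoint elements to unitaries and its derivative at `0` is the inclusion. -/
def cayleyInvVal (a : A) : A := (2 : ℝ) • Ring.inverse (1 - (1 / 2 : ℝ) • a) - 1

theorem cayleyInvVal_mem (a : SkewElt A) : cayleyInvVal (a : A) ∈ unitary A := by
  have hs : star (a : A) = -(a : A) := a.2
  have hu := isUnit_one_sub_half a
  have hu' : IsUnit (1 + (1 / 2 : ℝ) • (a : A)) := by
    have := isUnit_one_sub_half (-a)
    simpa using this
  set x : A := (1 / 2 : ℝ) • (a : A) with hx
  obtain ⟨Q, hQ⟩ := hu
  obtain ⟨P, hP⟩ := hu'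
  have e1 : star (Ring.inverse (1 - x)) = Ring.inverse (1 + x) := by
    rw [← Ring.inverse_star]; simp [hx, hs]
  have key : ∀ P Q : Aˣ, (P : A) + Q = 2 →
      ((2 : ℝ) • (↑P⁻¹ : A) - 1) * ((2 : ℝ) • (↑Q⁻¹ : A) - 1) = 1 := by
    intro P Q h
    have h' : (↑P⁻¹ : A) * ((P : A) + Q) * (↑Q⁻¹ : A) = ↑P⁻¹ * 2 * ↑Q⁻¹ := by rw [h]
    rw [mul_add, add_mul] at h'
    simp [mul_assoc] at h'
    have h2 : (↑P⁻¹ : A) * (2 * ↑Q⁻¹) = (2 : ℝ) • ((↑P⁻¹ : A) * ↑Q⁻¹) := by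
      rw [two_smul, two_mul, mul_add]
    rw [h2] at h'
    have : ((2 : ℝ) • (↑P⁻¹ : A) - 1) * ((2 : ℝ) • (↑Q⁻¹ : A) - 1)
      = (2 : ℝ) • ((2 : ℝ) • ((↑P⁻¹ : A) * ↑Q⁻¹)) - (2 : ℝ) • ((↑Q⁻¹ : A) + ↑P⁻¹) + 1 := by
      rw [sub_mul, mul_sub, smul_mul_smul_comm, smul_smul]
      simp only [mul_one, one_mul, smul_add]; abel
    rw [this, ← h']; simp
  have hPQ : (P : A) + Q = 2 := by
    rw [hP, hQ]; rw [add_add_sub_cancel]; norm_num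
  have hst : star (cayleyInvVal (a : A)) = (2 : ℝ) • (↑P⁻¹ : A) - 1 := by
    unfold cayleyInvVal
    rw [star_sub, star_smul, e1, ← hP, Ring.inverse_unit]; simp
  have hc : cayleyInvVal (a : A) = (2 : ℝ) • (↑Q⁻¹ : A) - 1 := by
    unfold cayleyInvVal
    rw [← hx, ← hQ, Ring.inverse_unit]
  rw [Unitary.mem_iff, hst, hc]
  exact ⟨key P Q hPQ, key Q P (by rw [add_comm]; exact hPQ)⟩

/-- The inverse `u ↦ 2(u - 1)(u + 1)⁻¹ = 2 - 4(1 + u)⁻¹` of the Cayley transform. -/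
def cayleyVal (u : A) : A := (2 : ℝ) • 1 - (4 : ℝ) • Ring.inverse (1 + u)

theorem cayleyVal_mem {u : A} (hu : u ∈ unitary A) (h : IsUnit (1 + u)) :
    cayleyVal u ∈ SkewElt A := by
  have h' : IsUnit (1 + star u) := by simpa using h.star
  have e1 : star (Ring.inverse (1 + u)) = Ring.inverse (1 + star u) := by
    rw [← Ring.inverse_star]; simp
  obtain ⟨P, hP⟩ := h
  obtain ⟨Q, hQ⟩ := h'
  have hPQ : (P : A) * Q = P + Q := by
    rw [hP, hQ, add_mul, mul_add, mul_add, (Unitary.mem_iff.1 hu).2]; simp; abel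
  have h3 : (↑P⁻¹ : A) + ↑Q⁻¹ = 1 := by
    have : (↑P⁻¹ : A) * ((P : A) * Q) * (↑Q⁻¹ : A) = ↑P⁻¹ * (P + Q) * ↑Q⁻¹ := by rw [hPQ]
    rw [mul_add, add_mul] at this
    simp [mul_assoc] at this
    rw [add_comm]; exact this.symm
  change star (cayleyVal u) = - cayleyVal u
  unfold cayleyVal
  rw [star_sub, star_smul, star_smul, e1, ← hP, ← hQ, Ring.inverse_unit, Ring.inverse_unit]
  rw [eq_neg_iff_add_eq_zero]
  have : (star (2:ℝ) • star (1:A) - star (4:ℝ) • (↑Q⁻¹ : A)) + ((2:ℝ) • (1:A) - (4:ℝ) • (↑P⁻¹:A))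
    = (4 : ℝ) • (1 - (↑P⁻¹ + ↑Q⁻¹)) := by
      simp only [star_trivial, star_one]; module
  rw [this, h3]; simp

theorem one_add_cayleyInvVal (a : A) :
    1 + cayleyInvVal a = (2 : ℝ) • Ring.inverse (1 - (1 / 2 : ℝ) • a) := by
  unfold cayleyInvVal; abel

theorem isUnit_one_add_cayleyInvVal (a : SkewElt A) : IsUnit (1 + cayleyInvVal (a : A)) := by
  rw [one_add_cayleyInvVal]
  exact ((isUnit_one_sub_half a).ringInverse).smul (Units.mk0 (2 : ℝ) two_ne_zero)

theorem ringInverse_smul (r : ℝ) (hr : r ≠ 0) (x : A) (hx : IsUnit x) :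
    Ring.inverse (r • x) = r⁻¹ • Ring.inverse x := by
  have h1 : IsUnit (r • x) := hx.smul (Units.mk0 r hr)
  have h2 : (r⁻¹ • Ring.inverse x) * (r • x) = 1 := by
    rw [smul_mul_smul_comm, inv_mul_cancel₀ hr, Ring.inverse_mul_cancel _ hx, one_smul]
  calc Ring.inverse (r • x) = (r⁻¹ • Ring.inverse x) * (r • x) * Ring.inverse (r • x) := by
        rw [h2, one_mul]
    _ = _ := by rw [mul_assoc, Ring.mul_inverse_cancel _ h1, mul_one]

theorem cayleyVal_cayleyInvVal (a : SkewElt A) : cayleyVal (cayleyInvVal (a : A)) = a := by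
  unfold cayleyVal
  rw [one_add_cayleyInvVal, ringInverse_smul _ two_ne_zero _ (isUnit_one_sub_half a).ringInverse,
    Ring.inverse_inverse (isUnit_one_sub_half a)]
  module

theorem cayleyInvVal_cayleyVal {u : A} (h : IsUnit (1 + u)) :
    cayleyInvVal (cayleyVal u) = u := by
  unfold cayleyInvVal cayleyVal
  have : (1 : A) - (1 / 2 : ℝ) • ((2 : ℝ) • 1 - (4 : ℝ) • Ring.inverse (1 + u))
    = (2 : ℝ) • Ring.inverse (1 + u) := by module
  rw [this, ringInverse_smul _ two_ne_zero _ h.ringInverse, Ring.inverse_inverse h]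
  module

theorem contDiff_cayleyInvVal : ContDiff ℝ ∞ (fun a : SkewElt A => cayleyInvVal (a : A)) := by
  rw [contDiff_iff_contDiffAt]
  intro a
  obtain ⟨u, hu⟩ := isUnit_one_sub_half a
  have h1 : ContDiffAt ℝ ∞ (Ring.inverse : A → A) (1 - (1 / 2 : ℝ) • (a : A)) :=
    hu ▸ contDiffAt_ringInverse ℝ u
  have h0 : ContDiffAt ℝ ∞ (fun a : SkewElt A => (1 : A) - (1 / 2 : ℝ) • (a : A)) a :=
    contDiffAt_const.sub ((SkewElt A).subtypeL.contDiff.contDiffAt.const_smul _)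
  exact ((h1.comp a h0).const_smul (2 : ℝ)).sub contDiffAt_const

/-- The projection of the algebra onto its skew-adjoint part. -/
def skewPart : A →L[ℝ] SkewElt A where
  toFun x := ⟨(1 / 2 : ℝ) • (x - star x), by
    change star _ = - _
    simp [← smul_neg]⟩
  map_add' x y := by ext; simp; module
  map_smul' r x := by ext; simp; module
  cont := by fun_prop

theorem skewPart_coe (a : SkewElt A) : skewPart (a : A) = a := by
  have hs : star (a : A) = -(a : A) := a.2
  ext
  change (1 / 2 : ℝ) • ((a : A) - star (a : A)) = a
  rw [hs]; module

/-- The Cayley chart at `g`, as a map defined on the ambient algebra. -/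
def chartVal (g : unitary A) (x : A) : SkewElt A := skewPart (cayleyVal (star (g : A) * x))

theorem contDiffAt_chartVal (g : unitary A) {x : A} (hx : IsUnit (1 + star (g : A) * x)) :
    ContDiffAt ℝ ∞ (chartVal g) x := by
  obtain ⟨u, hu⟩ := hx
  have h1 : ContDiffAt ℝ ∞ (Ring.inverse : A → A) (1 + star (g : A) * x) :=
    hu ▸ contDiffAt_ringInverse ℝ u
  have h0 : ContDiffAt ℝ ∞ (fun x : A => 1 + star (g : A) * x) x :=
    contDiffAt_const.add (contDiffAt_const.mul contDiffAt_id)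
  exact skewPart.contDiff.contDiffAt.comp x
    (contDiffAt_const.sub ((h1.comp x h0).const_smul (4 : ℝ)))

/-- The Cayley chart at `g`: it sends `u` with `1 + g⁻¹u` invertible to `2(g⁻¹u - 1)(g⁻¹u + 1)⁻¹`
and is a homeomorphism onto the space of skew-adjoint elements. -/
def cayleyChart (g : unitary A) : OpenPartialHomeomorph (unitary A) (SkewElt A) where
  toFun u := chartVal g u
  invFun a := g * ⟨cayleyInvVal (a : A), cayleyInvVal_mem a⟩
  source := {u | IsUnit (1 + star (g : A) * u)}
  target := Set.univ
  map_source' _ _ := Set.mem_univ _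
  map_target' a _ := by
    have : star (g : A) * ((g : A) * cayleyInvVal (a : A)) = cayleyInvVal (a : A) := by
      rw [← mul_assoc]; simp
    change IsUnit (1 + star (g : A) * ((g : A) * cayleyInvVal (a : A)))
    rw [this]
    exact isUnit_one_add_cayleyInvVal a
  left_inv' u hu := by
    ext
    have hm : star (g : A) * u ∈ unitary A := (star g * u).2
    change (g : A) * cayleyInvVal (skewPart (cayleyVal (star (g : A) * u)) : A) = u
    have := skewPart_coe ⟨_, cayleyVal_mem hm hu⟩
    simp only at this
    rw [this, cayleyInvVal_cayleyVal hu, ← mul_assoc]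
    simp
  right_inv' a _ := by
    have : star (g : A) * ((g : A) * cayleyInvVal (a : A)) = cayleyInvVal (a : A) := by
      rw [← mul_assoc]; simp
    change skewPart (cayleyVal (star (g : A) * ((g : A) * cayleyInvVal (a : A)))) = a
    rw [this, cayleyVal_cayleyInvVal, skewPart_coe]
  open_source := by
    have hc : Continuous (fun u : unitary A => 1 + star (g : A) * (u : A)) := by fun_prop
    exact Units.isOpen.preimage hc
  open_target := isOpen_univ
  continuousOn_toFun := by
    intro u hu
    have h := (contDiffAt_chartVal g hu).continuousAt
    exact (ContinuousAt.comp (f := fun u : unitary A => (u : A)) h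
      continuous_subtype_val.continuousAt).continuousWithinAt
  continuousOn_invFun := by
    have h := (contDiff_cayleyInvVal (A := A)).continuous
    refine Continuous.continuousOn ?_
    exact continuous_const.mul (h.subtype_mk _)

theorem mem_cayleyChart_source (g : unitary A) : g ∈ (cayleyChart g).source := by
  change IsUnit (1 + star (g : A) * g)
  have : (1 : A) + star (g : A) * g = (2 : ℝ) • 1 := by simp; module
  rw [this]
  exact isUnit_one.smul (Units.mk0 (2 : ℝ) two_ne_zero)

/-- The Banach manifold structure of the unitary group, with the Cayley charts. -/
instance : ChartedSpace (SkewElt A) (unitary A) where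
  atlas := Set.range cayleyChart
  chartAt := cayleyChart
  mem_chart_source := mem_cayleyChart_source
  chart_mem_atlas g := Set.mem_range_self g

theorem coe_cayleyChart_symm (g : unitary A) (a : SkewElt A) :
    (((cayleyChart g).symm a : unitary A) : A) = g * cayleyInvVal (a : A) := rfl

theorem contDiff_coe_cayleyChart_symm (g : unitary A) :
    ContDiff ℝ ∞ (fun a => (((cayleyChart g).symm a : unitary A) : A)) :=
  contDiff_const.mul contDiff_cayleyInvVal

instance : IsManifold 𝓘(ℝ, SkewElt A) ∞ (unitary A) := by
  refine isManifold_of_contDiffOn _ _ _ ?_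
  rintro _ _ ⟨g, rfl⟩ ⟨h, rfl⟩
  intro a ha
  have ha' : IsUnit (1 + star (h : A) * (((cayleyChart g).symm a : unitary A) : A)) := by
    have := ha.1
    simp at this
    exact this.2
  exact (ContDiffAt.comp a (contDiffAt_chartVal h ha')
    (contDiff_coe_cayleyChart_symm g).contDiffAt).contDiffWithinAt

/-- The inclusion of the unitary group into the algebra is smooth. -/
theorem contMDiff_coe :
    ContMDiff 𝓘(ℝ, SkewElt A) 𝓘(ℝ, A) ∞ (fun u : unitary A => (u : A)) := by
  intro g
  rw [contMDiffAt_iff]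
  refine ⟨continuous_subtype_val.continuousAt, ?_⟩
  exact ((contDiff_coe_cayleyChart_symm g).contDiffAt).contDiffWithinAt

/-- A map into the unitary group is smooth if it is smooth as a map into the algebra. -/
theorem contMDiffAt_of_coe {E H M : Type*} [NormedAddCommGroup E] [NormedSpace ℝ E]
    [TopologicalSpace H] {I : ModelWithCorners ℝ E H} [TopologicalSpace M] [ChartedSpace H M]
    {f : M → unitary A} {x : M} (hf : ContMDiffAt I 𝓘(ℝ, A) ∞ (fun y => (f y : A)) x) :
    ContMDiffAt I 𝓘(ℝ, SkewElt A) ∞ f x := by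
  rw [contMDiffAt_iff_target]
  refine ⟨Topology.IsInducing.subtypeVal.continuousAt_iff.2 hf.continuousAt, ?_⟩
  have h1 := contDiffAt_chartVal (f x) (mem_cayleyChart_source (f x))
  exact ContMDiffAt.comp (I' := 𝓘(ℝ, A)) (g := chartVal (f x)) (f := fun y => (f y : A)) x
    h1.contMDiffAt hf

/-- The unitary group is a Banach Lie group. -/
instance : LieGroup 𝓘(ℝ, SkewElt A) ∞ (unitary A) where
  contMDiff_mul p := by
    apply contMDiffAt_of_coe
    have h1 := (contMDiff_coe (A := A)).comp
      (contMDiff_fst (I := 𝓘(ℝ, SkewElt A)) (J := 𝓘(ℝ, SkewElt A)) (M := unitary A) (N := unitary A))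
    have h2 := (contMDiff_coe (A := A)).comp
      (contMDiff_snd (I := 𝓘(ℝ, SkewElt A)) (J := 𝓘(ℝ, SkewElt A)) (M := unitary A) (N := unitary A))
    exact (contDiff_mul (𝕜 := ℝ) (𝔸 := A)).contMDiff.contMDiffAt.comp p
      (h1.prodMk_space h2).contMDiffAt
  contMDiff_inv p := by
    apply contMDiffAt_of_coe
    exact (starL' ℝ : A ≃L[ℝ] A).contDiff.contMDiff.contMDiffAt.comp p
      (contMDiff_coe (A := A)).contMDiffAt

set_option synthInstance.maxHeartbeats 200000 in
theorem hasFDerivAt_cayleyInvVal :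
    HasFDerivAt (fun a : SkewElt A => cayleyInvVal (a : A)) (SkewElt A).subtypeL 0 := by
  have h1 := hasFDerivAt_ringInverse (𝕜 := ℝ) (1 : Aˣ)
  have h0 : HasFDerivAt (fun a : SkewElt A => (1 : A) - (1 / 2 : ℝ) • (a : A))
      (-((1 / 2 : ℝ) • (SkewElt A).subtypeL)) 0 :=
    ((SkewElt A).subtypeL.hasFDerivAt.const_smul (1 / 2 : ℝ)).const_sub 1
  have e : (1 : A) - (1 / 2 : ℝ) • ((0 : SkewElt A) : A) = ((1 : Aˣ) : A) := by simp
  rw [← e] at h1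
  have h2 := ((h1.comp (0 : SkewElt A) h0).const_smul (2 : ℝ)).sub_const (1 : A)
  refine h2.congr_fderiv ?_
  ext a
  simp

theorem cayleyChart_self (g : unitary A) : cayleyChart g g = 0 := by
  have h := (cayleyChart g).right_inv (x := 0) (Set.mem_univ _)
  have h2 : (cayleyChart g).symm 0 = g := by
    ext
    have h0 : cayleyInvVal (0 : A) = 1 := by
      unfold cayleyInvVal
      rw [smul_zero, sub_zero, Ring.inverse_one]
      module
    rw [coe_cayleyChart_symm]
    change (g : A) * cayleyInvVal (0 : A) = g
    rw [h0, mul_one]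
  rwa [h2] at h

/-- The identification of the tangent space at `g` with the model space given by the chart is the
left translation: the vector `X` is the ambient tangent vector `g X`. -/
theorem mfderiv_coe (g : unitary A) (X : TangentSpace 𝓘(ℝ, SkewElt A) g) :
    (mfderiv 𝓘(ℝ, SkewElt A) 𝓘(ℝ, A) (fun u : unitary A => (u : A)) g X : A)
      = (g : A) * ((show SkewElt A from X : SkewElt A) : A) := by
  have hd : MDifferentiableAt 𝓘(ℝ, SkewElt A) 𝓘(ℝ, A) (fun u : unitary A => (u : A)) g :=
    (contMDiff_coe (A := A)).mdifferentiableAt (by simp)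
  rw [hd.mfderiv]
  have h : HasFDerivAt (writtenInExtChartAt 𝓘(ℝ, SkewElt A) 𝓘(ℝ, A) g
      (fun u : unitary A => (u : A)))
      ((ContinuousLinearMap.mul ℝ A (g : A)).comp (SkewElt A).subtypeL)
      (extChartAt 𝓘(ℝ, SkewElt A) g g) := by
    have e : extChartAt 𝓘(ℝ, SkewElt A) g g = (0 : SkewElt A) := cayleyChart_self g
    rw [e]
    exact (ContinuousLinearMap.mul ℝ A (g : A)).hasFDerivAt.comp (0 : SkewElt A)
      hasFDerivAt_cayleyInvVal
  rw [h.hasFDerivWithinAt.fderivWithin (by simp)]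
  rfl

end
end UnitaryManifold

/-! ### Banach sub-Poisson manifolds -/

section SubPoisson

variable {E M : Type*} [NormedAddCommGroup E] [NormedSpace ℝ E]
  [TopologicalSpace M] [ChartedSpace E M]

/-- The expression of a 1-form `θ` on `M` in the preferred chart `φ` at `p`, i.e. the pull-back of
`θ` by `φ⁻¹`, a 1-form on an open subset of the model space `E`. -/
def oneFormInChart (θ : ∀ q : M, TangentSpace 𝓘(ℝ, E) q →L[ℝ] ℝ) (p : M) : E → (E →L[ℝ] ℝ) :=
  fun y => (θ ((chartAt E p).symm y)).comp
    (mfderiv 𝓘(ℝ, E) 𝓘(ℝ, E) (chartAt E p).symm y)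

/-- The exterior derivative at `p` of a 1-form on `M`, computed in the preferred chart at `p`:
`dθ(X, Y) = (D_X θ)(Y) - (D_Y θ)(X)`. -/
def oneFormExtDeriv (θ : ∀ q : M, TangentSpace 𝓘(ℝ, E) q →L[ℝ] ℝ) (p : M) (X Y : E) : ℝ :=
  fderiv ℝ (oneFormInChart θ p) (chartAt E p p) X Y -
    fderiv ℝ (oneFormInChart θ p) (chartAt E p p) Y X

end SubPoisson

/-- A duality between a Banach bundle `V` (with typical fiber `F`) over the Banach manifold `M`
and the tangent bundle of `M`: non-degenerate continuous bilinear pairings between the fibers of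
`V` and of `TM`, which depend smoothly on the base point. A section of `V` is regarded as a 1-form
on `M` through `pairing`. -/
structure DualityPairing (E M : Type*) [NormedAddCommGroup E] [NormedSpace ℝ E]
    [CompleteSpace E] [TopologicalSpace M] [ChartedSpace E M] [IsManifold 𝓘(ℝ, E) ∞ M]
    (F : Type*) [NormedAddCommGroup F] [NormedSpace ℝ F] [CompleteSpace F]
    (V : M → Type*) [∀ p, AddCommGroup (V p)] [∀ p, Module ℝ (V p)]
    [∀ p, TopologicalSpace (V p)] [∀ p, IsTopologicalAddGroup (V p)]
    [∀ p, ContinuousSMul ℝ (V p)] [TopologicalSpace (TotalSpace F V)]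
    [FiberBundle F V] [VectorBundle ℝ F V] [ContMDiffVectorBundle ∞ F V 𝓘(ℝ, E)] where
  /-- The pairing between the fiber of the bundle and the tangent space at `p`. -/
  pairing (p : M) : V p →L[ℝ] TangentSpace 𝓘(ℝ, E) p →L[ℝ] ℝ
  contMDiff_pairing : ContMDiff 𝓘(ℝ, E) (𝓘(ℝ, E).prod 𝓘(ℝ, F →L[ℝ] E →L[ℝ] ℝ)) ∞
    (fun p => TotalSpace.mk' (F →L[ℝ] E →L[ℝ] ℝ)
      (E := fun p => V p →L[ℝ] TangentSpace 𝓘(ℝ, E) p →L[ℝ] ℝ) p (pairing p))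
  eq_zero_left (p : M) (α : V p) : (∀ X, pairing p α X = 0) → α = 0
  eq_zero_right (p : M) (X : TangentSpace 𝓘(ℝ, E) p) : (∀ α, pairing p α X = 0) → X = 0

namespace DualityPairing

variable {E M : Type*} [NormedAddCommGroup E] [NormedSpace ℝ E]
    [CompleteSpace E] [TopologicalSpace M] [ChartedSpace E M] [IsManifold 𝓘(ℝ, E) ∞ M]
    {F : Type*} [NormedAddCommGroup F] [NormedSpace ℝ F] [CompleteSpace F]
    {V : M → Type*} [∀ p, AddCommGroup (V p)] [∀ p, Module ℝ (V p)]
    [∀ p, TopologicalSpace (V p)] [∀ p, IsTopologicalAddGroup (V p)]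
    [∀ p, ContinuousSMul ℝ (V p)] [TopologicalSpace (TotalSpace F V)]
    [FiberBundle F V] [VectorBundle ℝ F V] [ContMDiffVectorBundle ∞ F V 𝓘(ℝ, E)]

/-- `α` restricts to a smooth section of the bundle over the open set `U` (its values outside `U`
are irrelevant). -/
def IsLocalSection (_P : DualityPairing E M F V) (U : Set M) (α : ∀ p, V p) : Prop :=
  IsOpen U ∧ ContMDiffOn 𝓘(ℝ, E) (𝓘(ℝ, E).prod 𝓘(ℝ, F)) ∞ (fun p => TotalSpace.mk' F p (α p)) U

/-- `α` is a smooth section over the open set `U` which is closed as a 1-form on `U`. -/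
def IsClosedLocalSection (P : DualityPairing E M F V) (U : Set M) (α : ∀ p, V p) : Prop :=
  P.IsLocalSection U α ∧
    ∀ p ∈ U, ∀ X Y : E, oneFormExtDeriv (fun q => P.pairing q (α q)) p X Y = 0

/-- The element `a` of the fiber at `p` is, as a functional on the tangent space, the differential
of `f` at `p`. -/
def IsDifferentialAt (P : DualityPairing E M F V) (f : M → ℝ) (p : M) (a : V p) : Prop :=
  ∀ X : TangentSpace 𝓘(ℝ, E) p, P.pairing p a X = mfderiv 𝓘(ℝ, E) 𝓘(ℝ, ℝ) f p X

end DualityPairing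

/-- A Banach sub-Poisson structure on the Banach manifold `M`: a Banach bundle `V` in duality with
the tangent bundle, and a smooth field of continuous skew-symmetric bilinear forms on its fibers
which is a Poisson tensor. -/
structure SubPoissonStructure (E M : Type*) [NormedAddCommGroup E] [NormedSpace ℝ E]
    [CompleteSpace E] [TopologicalSpace M] [ChartedSpace E M] [IsManifold 𝓘(ℝ, E) ∞ M]
    (F : Type*) [NormedAddCommGroup F] [NormedSpace ℝ F] [CompleteSpace F]
    (V : M → Type*) [∀ p, AddCommGroup (V p)] [∀ p, Module ℝ (V p)]
    [∀ p, TopologicalSpace (V p)] [∀ p, IsTopologicalAddGroup (V p)]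
    [∀ p, ContinuousSMul ℝ (V p)] [TopologicalSpace (TotalSpace F V)]
    [FiberBundle F V] [VectorBundle ℝ F V] [ContMDiffVectorBundle ∞ F V 𝓘(ℝ, E)]
    extends DualityPairing E M F V where
  /-- The Poisson tensor. -/
  tensor (p : M) : V p →L[ℝ] V p →L[ℝ] ℝ
  tensor_skew (p : M) (α β : V p) : tensor p α β = - tensor p β α
  contMDiff_tensor : ContMDiff 𝓘(ℝ, E) (𝓘(ℝ, E).prod 𝓘(ℝ, F →L[ℝ] F →L[ℝ] ℝ)) ∞
    (fun p => TotalSpace.mk' (F →L[ℝ] F →L[ℝ] ℝ)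
      (E := fun p => V p →L[ℝ] V p →L[ℝ] ℝ) p (tensor p))
  /-- For closed local sections `α`, `β`, the differential of `π(α, β)` is a local section. -/
  exists_differential (U : Set M) (α β : ∀ p, V p) :
    toDualityPairing.IsClosedLocalSection U α → toDualityPairing.IsClosedLocalSection U β →
    ∃ σ : ∀ p, V p, toDualityPairing.IsLocalSection U σ ∧
      ∀ p ∈ U, toDualityPairing.IsDifferentialAt (fun q => tensor q (α q) (β q)) p (σ p)
  /-- The Jacobi identity for closed local sections, where `a`, `b`, `c` are the values at `p` of
  `d(π(β, γ))`, `d(π(γ, α))` and `d(π(α, β))`. -/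
  jacobi (U : Set M) (α β γ : ∀ p, V p) :
    toDualityPairing.IsClosedLocalSection U α → toDualityPairing.IsClosedLocalSection U β →
    toDualityPairing.IsClosedLocalSection U γ → ∀ p ∈ U, ∀ a b c : V p,
      toDualityPairing.IsDifferentialAt (fun q => tensor q (β q) (γ q)) p a →
      toDualityPairing.IsDifferentialAt (fun q => tensor q (γ q) (α q)) p b →
      toDualityPairing.IsDifferentialAt (fun q => tensor q (α q) (β q)) p c →
      tensor p (α p) a + tensor p (β p) b + tensor p (γ p) c = 0

/-- The condition on the tangent map `T` of a map at a point to be Poisson there. Here `V₁`, `V₂`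
are the fibers of the two bundles at the point and at its image, `pair₁`, `pair₂` their pairings
with the tangent spaces, `π₁`, `π₂` the two tensors. The transpose of `T` maps `V₂` to `V₁`, its
restriction `S : V₂ → V₁` is continuous (and unique, the pairing being non-degenerate), and `S`
carries `π₂` to `π₁`. -/
def IsPoissonLinear {T₁ T₂ V₁ V₂ : Type*}
    [AddCommGroup V₁] [Module ℝ V₁] [TopologicalSpace V₁]
    [AddCommGroup V₂] [Module ℝ V₂] [TopologicalSpace V₂]
    (pair₁ : V₁ → T₁ → ℝ) (π₁ : V₁ → V₁ → ℝ) (pair₂ : V₂ → T₂ → ℝ) (π₂ : V₂ → V₂ → ℝ)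
    (T : T₁ → T₂) : Prop :=
  ∃ S : V₂ →L[ℝ] V₁, (∀ α X, pair₁ (S α) X = pair₂ α (T X)) ∧
    ∀ α β, π₁ (S α) (S β) = π₂ α β

/-- The sum of two bilinear pairings, on the products; it gives both the pairing and the tensor of
a product of sub-Poisson manifolds. -/
def prodForm {X₁ X₂ Y₁ Y₂ : Type*} (B₁ : X₁ → Y₁ → ℝ) (B₂ : X₂ → Y₂ → ℝ) :
    X₁ × X₂ → Y₁ × Y₂ → ℝ :=
  fun x y => B₁ x.1 y.1 + B₂ x.2 y.2

/-- A Banach Poisson--Lie group structure on the Banach Lie group `G`: a Banach sub-Poisson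
structure for which the multiplication `G × G → G` is a Poisson map at every point, where `G × G`
carries the product structure, whose fiber at `(g, h)` is `V g × V h`. -/
structure PoissonLieStructure (E G : Type*) [NormedAddCommGroup E] [NormedSpace ℝ E]
    [CompleteSpace E] [Group G] [TopologicalSpace G] [ChartedSpace E G] [LieGroup 𝓘(ℝ, E) ∞ G]
    (F : Type*) [NormedAddCommGroup F] [NormedSpace ℝ F] [CompleteSpace F]
    (V : G → Type*) [∀ g, AddCommGroup (V g)] [∀ g, Module ℝ (V g)]
    [∀ g, TopologicalSpace (V g)] [∀ g, IsTopologicalAddGroup (V g)]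
    [∀ g, ContinuousSMul ℝ (V g)] [TopologicalSpace (TotalSpace F V)]
    [FiberBundle F V] [VectorBundle ℝ F V] [ContMDiffVectorBundle ∞ F V 𝓘(ℝ, E)]
    extends SubPoissonStructure E G F V where
  isPoisson_mul (g h : G) :
    IsPoissonLinear
      (T₁ := TangentSpace 𝓘(ℝ, E) g × TangentSpace 𝓘(ℝ, E) h)
      (T₂ := TangentSpace 𝓘(ℝ, E) (g * h)) (V₁ := V g × V h) (V₂ := V (g * h))
      (prodForm (fun α X => pairing g α X) (fun α X => pairing h α X))
      (prodForm (fun α β => tensor g α β) (fun α β => tensor h α β))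
      (fun α X => pairing (g * h) α X) (fun α β => tensor (g * h) α β)
      (mfderiv (𝓘(ℝ, E).prod 𝓘(ℝ, E)) 𝓘(ℝ, E) (fun q : G × G => q.1 * q.2) (g, h))

/-! ### Triangular trace-class operators -/

section TraceClass

variable {H : Type*} [NormedAddCommGroup H] [InnerProductSpace ℂ H] [CompleteSpace H]

/-- `T` is a trace-class operator: `∑ ⟨n| |T| |n⟩ < ∞` with `|T| = (T^*T)^{1/2}`. The condition
does not depend on the Hilbert basis. -/
def IsTraceClass (b : HilbertBasis ℤ ℂ H) (T : H →L[ℂ] H) : Prop :=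
  Summable fun n => (inner ℂ (b n) (CFC.abs T (b n))).re

/-- The trace `∑ ⟨n|T|n⟩` of a trace-class operator. -/
def operatorTrace (b : HilbertBasis ℤ ℂ H) (T : H →L[ℂ] H) : ℂ :=
  ∑' n, inner ℂ (b n) (T (b n))

/-- The space `b_1^+(H)` of trace-class operators which map each basis vector `|n⟩` to the closed
linear span of the `|m⟩` with `m ≥ n`, and whose diagonal coefficients are real. -/
def upperTriangularTraceClass (b : HilbertBasis ℤ ℂ H) : Set (H →L[ℂ] H) :=
  {T | IsTraceClass b T ∧
    ∀ n, T (b n) ∈ (Submodule.span ℂ (b '' Set.Ici n)).topologicalClosure ∧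
      (inner ℂ (b n) (T (b n))).im = 0}

/-- The functional on the tangent space of `U(H)` at the identity given by `B`, namely
`A ↦ Im Tr(AB)`. A tangent vector `X` is identified with a skew-adjoint operator `A` through the
derivative of the inclusion of `U(H)` into the bounded operators. -/
def imTracePairing (b : HilbertBasis ℤ ℂ H) (B : H →L[ℂ] H)
    (X : TangentSpace 𝓘(ℝ, SkewElt (H →L[ℂ] H)) (1 : unitary (H →L[ℂ] H))) : ℝ :=
  let A : H →L[ℂ] H := mfderiv 𝓘(ℝ, SkewElt (H →L[ℂ] H)) 𝓘(ℝ, H →L[ℂ] H)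
    (fun u : unitary (H →L[ℂ] H) => (u : H →L[ℂ] H)) 1 X
  (operatorTrace b (A * B)).im

/-- The image of `b_1^+(H)` in the dual of `u(H)`, under the pairing `(A, B) ↦ Im Tr(AB)`. -/
def dualImage (b : HilbertBasis ℤ ℂ H) :
    Set (TangentSpace 𝓘(ℝ, SkewElt (H →L[ℂ] H)) (1 : unitary (H →L[ℂ] H)) →L[ℝ] ℝ) :=
  {l | ∃ B ∈ upperTriangularTraceClass b, ∀ X, l X = imTracePairing b B X}

end TraceClass

end

/-! The obstruction already lies in the transpose condition. Since multiplication is a Poisson map,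
the transposes of left and right translations carry fibers of the bundle into fibers, so the fiber
at the identity is stable under the coadjoint action (`exists_pairing_coadjoint`). It remains to see
that `b_1^+(H)` is not stable.

The projection onto `b 0` lies in `b_1^+(H)`. A unitary conjugates it to the projection onto any
unit vector `v` orthogonal to `b 0`, so some `B` in `b_1^+(H)` would have to represent `A ↦ Im ⟨v, A
v⟩`. Testing on skew-adjoint operators of rank at most two determines `B`: on indices where the
coefficients of `v` equal a real constant `a`, it has entries `2 a²` below the diagonal, `a²` on it
and `0` above (`inner_eq_of_pairing_eq`).

Triangular truncation is unbounded in trace norm. In the discrete Fourier basis of a block of length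
`N` on which `v` is constantly `a`, the diagonal entries of `B` have modulus `a² |cot(πk/N)|` for `k
≠ 0`, with sum of order `a² N log N` (`le_sum_norm_inner_fourierVec`). A trace-class operator has
one bound for such sums over all finite orthonormal families
(`IsTraceClass.exists_sum_norm_inner_le`). A vector `v` with very long constant blocks makes `a² N
log N` unbounded (`exists_sparse_vector`), a contradiction. -/

/-! ### Diagonal sums of trace-class operators over orthonormal families -/

section TraceClass

variable {H : Type*} [NormedAddCommGroup H] [InnerProductSpace ℂ H]

theorem hasSum_norm_sq_inner (b : HilbertBasis ℤ ℂ H) (x : H) :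
    HasSum (fun n => ‖inner ℂ (b n) x‖ ^ 2) (‖x‖ ^ 2) := by
  have h := b.hasSum_inner_mul_inner x x
  have h2 := h.mapL (Complex.reCLM)
  convert h2 using 1
  · ext n
    rw [← inner_conj_symm x (b n), ← Complex.normSq_eq_conj_mul_self]
    simp only [Complex.reCLM_apply, Complex.ofReal_re, Complex.normSq_eq_norm_sq]
  · rw [inner_self_eq_norm_sq_to_K]
    norm_cast

variable [CompleteSpace H]

/-- Both squared norms equal `⟨x, T* T x⟩`, because `|T|² = T* T`. -/
theorem norm_cfcAbs_apply (T : H →L[ℂ] H) (x : H) : ‖CFC.abs T x‖ = ‖T x‖ := by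
  have h : ∀ A : H →L[ℂ] H, inner ℂ x ((star A * A) x) = ((‖A x‖ ^ 2 : ℝ) : ℂ) := by
    intro A
    rw [ContinuousLinearMap.star_eq_adjoint, mul_apply_eq_comp,
      ContinuousLinearMap.adjoint_inner_right, inner_self_eq_norm_sq_to_K]
    norm_cast
  have h1 := h (CFC.abs T)
  rw [(CFC.abs_nonneg T).isSelfAdjoint.star_eq, CFC.abs_mul_abs, h T] at h1
  have h2 : ‖T x‖ ^ 2 = ‖CFC.abs T x‖ ^ 2 := by exact_mod_cast h1
  exact ((sq_eq_sq₀ (norm_nonneg _) (norm_nonneg _)).1 h2).symm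

/-- The partial isometry of the polar decomposition, recorded only as a contraction. -/
theorem exists_contraction_comp_cfcAbs (T : H →L[ℂ] H) :
    ∃ W : H →L[ℂ] H, (∀ x, ‖W x‖ ≤ ‖x‖) ∧ ∀ x, W (CFC.abs T x) = T x := by
  set P := CFC.abs T
  let K : Submodule ℂ H := (LinearMap.range (P : H →ₗ[ℂ] H)).topologicalClosure
  have hPK : ∀ x, P x ∈ K := fun x => subset_closure ⟨x, rfl⟩
  let e : H →ₗ[ℂ] K := (P : H →ₗ[ℂ] H).codRestrict K hPK
  have hd : DenseRange e := by
    intro y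
    rw [Topology.IsInducing.subtypeVal.closure_eq_preimage_closure_image]
    have : (Subtype.val '' Set.range e : Set H) = Set.range P := by
      rw [← Set.range_comp]; rfl
    rw [Set.mem_preimage]
    exact this ▸ y.2
  have hn : ∀ x, ‖(T : H →ₗ[ℂ] H) x‖ ≤ 1 * ‖e x‖ := by
    intro x
    rw [one_mul]
    exact (norm_cfcAbs_apply T x).ge
  have : CompleteSpace K := Submodule.isClosed_topologicalClosure _ |>.completeSpace_coe
  -- By `hn` the assignment `|T| x ↦ T x` is a well-defined contraction on the range of `|T|`. It
  -- extends to the closure `K`, and precomposing with the projection makes it zero on the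
  -- complement of `K`.
  refine ⟨((T : H →ₗ[ℂ] H).extendOfNorm e).comp K.orthogonalProjectionOnto, fun x => ?_,
    fun x => ?_⟩
  · refine (LinearMap.norm_extendOfNorm_apply_le hd 1 hn _).trans ?_
    rw [one_mul]
    exact K.norm_orthogonalProjectionOnto_apply_le x
  · have h1 : K.orthogonalProjectionOnto (P x) = e x :=
      K.orthogonalProjectionOnto_mem_subspace_eq_self ⟨P x, hPK x⟩
    rw [ContinuousLinearMap.comp_apply, h1]
    exact LinearMap.extendOfNorm_eq hd ⟨1, hn⟩ x

/-- A Hilbert--Schmidt type bound: Hilbert--Schmidt sums of the adjoint over an orthonormal family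
are bounded by the Hilbert--Schmidt sum over a Hilbert basis. -/
theorem sum_norm_sq_adjoint_le (b : HilbertBasis ℤ ℂ H) (R : H →L[ℂ] H)
    (hR : Summable fun n => ‖R (b n)‖ ^ 2) {ι : Type*} [Fintype ι] {f : ι → H}
    (hf : Orthonormal ℂ f) :
    ∑ k, ‖ContinuousLinearMap.adjoint R (f k)‖ ^ 2 ≤ ∑' n, ‖R (b n)‖ ^ 2 := by
  have h1 := hasSum_sum (s := Finset.univ)
    (fun k _ => hasSum_norm_sq_inner b (ContinuousLinearMap.adjoint R (f k)))
  rw [← h1.tsum_eq]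
  -- Parseval has turned the left side into a sum over `n` of finite sums of `|⟨R (b n), f k⟩|²`
  -- over `k`; Bessel's inequality for `f` bounds each of these by `‖R (b n)‖²`.
  refine h1.summable.tsum_le_tsum (fun n => ?_) hR
  refine le_trans (le_of_eq ?_) (hf.sum_inner_products_le (R (b n)) (s := Finset.univ))
  refine Finset.sum_congr rfl fun k _ => ?_
  rw [ContinuousLinearMap.adjoint_inner_right, norm_inner_symm]

/-- Write `T = W S S` with `S = |T|^{1/2}` and `W` a contraction. Being trace class says that `S` is
Hilbert–Schmidt, hence so is `W S`. Then `⟨f, T f⟩ = ⟨(W S)* f, S f⟩` is at most `‖(W S)* f‖² + ‖S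
f‖²`, and the Hilbert–Schmidt bound applies to both terms. -/
theorem IsTraceClass.exists_sum_norm_inner_le {b : HilbertBasis ℤ ℂ H} {T : H →L[ℂ] H}
    (hT : IsTraceClass b T) :
    ∃ τ : ℝ, ∀ (ι : Type) [Fintype ι] (f : ι → H), Orthonormal ℂ f →
      ∑ k, ‖inner ℂ (f k) (T (f k))‖ ≤ τ := by
  obtain ⟨W, hW, hWT⟩ := exists_contraction_comp_cfcAbs T
  have hP : 0 ≤ CFC.abs T := CFC.abs_nonneg T
  set P := CFC.abs T
  set S := CFC.sqrt P
  have hS : ContinuousLinearMap.adjoint S = S := by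
    rw [← ContinuousLinearMap.star_eq_adjoint]
    exact (CFC.sqrt_nonneg P).isSelfAdjoint.star_eq
  have hSS : S * S = P := CFC.sqrt_mul_sqrt_self P hP
  have hn : ∀ x, ‖S x‖ ^ 2 = (inner ℂ x (P x)).re := by
    intro x
    rw [← hSS, mul_apply_eq_comp, ← ContinuousLinearMap.adjoint_inner_left, hS,
      inner_self_eq_norm_sq_to_K]
    norm_cast
  have hSs : Summable fun n => ‖S (b n)‖ ^ 2 := by
    simp only [hn]
    exact hT
  have hWS : Summable fun n => ‖(W * S) (b n)‖ ^ 2 :=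
    hSs.of_nonneg_of_le (fun n => by positivity)
      (fun n => pow_le_pow_left₀ (norm_nonneg _) (hW _) 2)
  refine ⟨∑' n, ‖(W * S) (b n)‖ ^ 2 + ∑' n, ‖S (b n)‖ ^ 2, fun ι _ f hf => ?_⟩
  have h1 := sum_norm_sq_adjoint_le b (W * S) hWS hf
  have h2 := sum_norm_sq_adjoint_le b S hSs hf
  rw [hS] at h2
  refine le_trans ?_ (add_le_add h1 h2)
  rw [← Finset.sum_add_distrib]
  refine Finset.sum_le_sum fun k _ => ?_
  have h3 : inner ℂ (f k) (T (f k))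
      = inner ℂ (ContinuousLinearMap.adjoint (W * S) (f k)) (S (f k)) := by
    rw [ContinuousLinearMap.adjoint_inner_left, ← hWT, ← hSS]
    rfl
  rw [h3]
  refine (norm_inner_le_norm _ _).trans ?_
  nlinarith [sq_nonneg (‖ContinuousLinearMap.adjoint (W * S) (f k)‖ - ‖S (f k)‖),
    sq_nonneg (‖ContinuousLinearMap.adjoint (W * S) (f k)‖), sq_nonneg ‖S (f k)‖]

end TraceClass

/-! ### Triangular matrices in the discrete Fourier basis -/

section Fourier

variable {H : Type*} [NormedAddCommGroup H] [InnerProductSpace ℂ H]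

/-- The `k`-th vector of the discrete Fourier basis of the span of `e 0, …, e (N - 1)`. -/
noncomputable def fourierVec (N : ℕ) (e : ℕ → H) (k : ℕ) : H :=
  ((√(N : ℝ))⁻¹ : ℂ) • ∑ j ∈ Finset.range N,
    (Complex.exp (2 * Real.pi * Complex.I / N) ^ k) ^ j • e j

theorem conj_rootOfUnity {N : ℕ} {z : ℂ} (hN : N ≠ 0) (hz : z ^ N = 1) :
    (starRingEnd ℂ) z = z⁻¹ := by
  rw [Complex.inv_def, Complex.normSq_eq_norm_sq, Complex.norm_eq_one_of_pow_eq_one hz hN]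
  simp

/-- Conjugates of roots of unity are written as inverses, so that the sums become geometric. The
case `T = id` gives orthonormality, the case `k = l` the diagonal entries. -/
theorem inner_fourierVec_apply {N : ℕ} (hN : N ≠ 0) (e : ℕ → H) (T : H →L[ℂ] H) (k l : ℕ) :
    inner ℂ (fourierVec N e k) (T (fourierVec N e l)) =
      (N : ℂ)⁻¹ * ∑ i ∈ Finset.range N, ∑ j ∈ Finset.range N,
        ((Complex.exp (2 * Real.pi * Complex.I / N) ^ k)⁻¹) ^ i *
          (Complex.exp (2 * Real.pi * Complex.I / N) ^ l) ^ j * inner ℂ (e i) (T (e j)) := by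
  have hw : Complex.exp (2 * Real.pi * Complex.I / N) ^ N = 1 :=
    (Complex.isPrimitiveRoot_exp N hN).pow_eq_one
  have hz : (Complex.exp (2 * Real.pi * Complex.I / N) ^ k) ^ N = 1 := by
    rw [pow_right_comm, hw, one_pow]
  have hs : ((√(N : ℝ))⁻¹ : ℂ) * ((√(N : ℝ))⁻¹ : ℂ) = (N : ℂ)⁻¹ := by
    rw [← mul_inv, ← Complex.ofReal_mul, Real.mul_self_sqrt (Nat.cast_nonneg N)]
    simp
  unfold fourierVec
  simp only [map_smul, map_sum, inner_smul_left, inner_smul_right, sum_inner, inner_sum, map_inv₀,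
    Complex.conj_ofReal, map_pow, conj_rootOfUnity hN hw]
  rw [← hs, mul_assoc, Finset.mul_sum]
  simp only [Finset.mul_sum, inv_pow]
  rw [Finset.sum_comm]
  refine Finset.sum_congr rfl fun i _ => Finset.sum_congr rfl fun j _ => ?_
  ring

theorem orthonormal_fourierVec {N : ℕ} {e : ℕ → H} (he : Orthonormal ℂ e) :
    Orthonormal ℂ (fun k : Fin N => fourierVec N e k) := by
  rw [orthonormal_iff_ite]
  intro k l
  have hN : N ≠ 0 := by have := k.2; omega
  have hw := Complex.isPrimitiveRoot_exp N hN
  have h := inner_fourierVec_apply hN e (ContinuousLinearMap.id ℂ H) k l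
  simp only [ContinuousLinearMap.id_apply] at h
  rw [h]
  set w := Complex.exp (2 * Real.pi * Complex.I / N)
  have h0 : w ≠ 0 := Complex.exp_ne_zero _
  have h1 : ∀ i ∈ Finset.range N, ∑ j ∈ Finset.range N,
      ((w ^ (k : ℕ))⁻¹) ^ i * (w ^ (l : ℕ)) ^ j * inner ℂ (e i) (e j)
      = ((w ^ (k : ℕ))⁻¹ * w ^ (l : ℕ)) ^ i := by
    intro i hi
    rw [Finset.sum_eq_single_of_mem i hi]
    · rw [inner_self_eq_norm_sq_to_K, he.1 i, mul_pow]
      simp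
    · intro j _ hj
      rw [he.2 hj.symm, mul_zero]
  rw [Finset.sum_congr rfl h1]
  split_ifs with hkl
  · rw [hkl, inv_mul_cancel₀ (pow_ne_zero _ h0)]
    simp [hN]
  -- The ratio of the geometric sum is a nontrivial `N`-th root of unity, so the sum vanishes.
  · have h2 : (w ^ (k : ℕ))⁻¹ * w ^ (l : ℕ) ≠ 1 := by
      intro h3
      rw [inv_mul_eq_one₀ (pow_ne_zero _ h0)] at h3
      exact hkl (Fin.ext (hw.pow_inj k.2 l.2 h3))
    rw [geom_sum_eq h2, mul_pow, inv_pow, pow_right_comm, pow_right_comm w (l : ℕ), hw.pow_eq_one]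
    simp

/-- With `z` the `k`-th power of the primitive root, the sum along row `i` is a truncated geometric
series, equal to a constant plus a multiple of `z⁻ⁱ`. The constant survives averaging over `i`,
while the powers of `z⁻¹` sum to zero because `z ≠ 1`; this is why `k = 0` is excluded. -/
theorem inner_fourierVec_triangular {N : ℕ} {e : ℕ → H} {T : H →L[ℂ] H} {a : ℂ}
    (hT : ∀ i < N, ∀ j < N, inner ℂ (e i) (T (e j)) = if j < i then 2 * a else if j = i then a else 0)
    {k : ℕ} (hk0 : k ≠ 0) (hk : k < N) :
    inner ℂ (fourierVec N e k) (T (fourierVec N e k)) =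
      a * (2 / (Complex.exp (2 * Real.pi * Complex.I / N) ^ k - 1) + 1) := by
  have hN : N ≠ 0 := by omega
  have hw := Complex.isPrimitiveRoot_exp N hN
  rw [inner_fourierVec_apply hN]
  set w := Complex.exp (2 * Real.pi * Complex.I / N)
  set z := w ^ k
  have hz : z ≠ 1 := hw.pow_ne_one_of_pos_of_lt hk0 hk
  have hz0 : z ≠ 0 := pow_ne_zero _ (Complex.exp_ne_zero _)
  have hzN : z ^ N = 1 := by
    change (w ^ k) ^ N = 1
    rw [pow_right_comm, hw.pow_eq_one, one_pow]
  clear_value z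
  have h1 : ∀ i ∈ Finset.range N, ∑ j ∈ Finset.range N, z⁻¹ ^ i * z ^ j * inner ℂ (e i) (T (e j))
      = a * (2 / (z - 1) + 1) - (2 * a / (z - 1)) * z⁻¹ ^ i := by
    intro i hi
    have hi' := Finset.mem_range.1 hi
    have h2 : ∑ j ∈ Finset.range N, z⁻¹ ^ i * z ^ j * inner ℂ (e i) (T (e j))
        = ∑ j ∈ Finset.range (i + 1), z⁻¹ ^ i * z ^ j * inner ℂ (e i) (T (e j)) := by
      symm
      refine Finset.sum_subset (Finset.range_mono (by omega)) fun j hj hj' => ?_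
      rw [Finset.mem_range] at hj hj'
      rw [hT i hi' j hj, if_neg (by omega), if_neg (by omega), mul_zero]
    rw [h2, Finset.sum_range_succ, hT i hi' i hi', if_neg (lt_irrefl _), if_pos rfl]
    have h3 : ∀ j ∈ Finset.range i, z⁻¹ ^ i * z ^ j * inner ℂ (e i) (T (e j))
        = z⁻¹ ^ i * (2 * a) * z ^ j := by
      intro j hj
      have hj' := Finset.mem_range.1 hj
      rw [hT i hi' j (by omega), if_pos hj']
      ring
    rw [Finset.sum_congr rfl h3, ← Finset.mul_sum, geom_sum_eq hz]
    have h4 : z⁻¹ ^ i * z ^ i = 1 := by rw [← mul_pow, inv_mul_cancel₀ hz0, one_pow]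
    linear_combination (2 * a / (z - 1) + a) * h4
  rw [Finset.sum_congr rfl h1, Finset.sum_sub_distrib, ← Finset.mul_sum (f := fun i => z⁻¹ ^ i),
    geom_sum_eq (by simpa using hz), inv_pow, hzN]
  simp [hN]

/-- The trace norm of the triangular truncation of the all-ones matrix of size `N` grows like
`N log N`. -/
theorem le_sum_norm_inner_fourierVec {N : ℕ} (hN : N ≠ 0) {e : ℕ → H} {T : H →L[ℂ] H} {a : ℝ}
    (ha : 0 ≤ a) (hT : ∀ i < N, ∀ j < N, inner ℂ (e i) (T (e j)) =
      if j < i then 2 * (a : ℂ) else if j = i then (a : ℂ) else 0) :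
    a * N * (Real.log N / Real.pi - 1) ≤
      ∑ k : Fin N, ‖inner ℂ (fourierVec N e k) (T (fourierVec N e k))‖ := by
  obtain ⟨n, rfl⟩ := Nat.exists_eq_succ_of_ne_zero hN
  rw [Finset.sum_fin_eq_sum_range, Finset.sum_range_succ']
  have h0 : (0 : ℝ) < (n.succ : ℕ) := by positivity
  have hpi := Real.pi_pos
  have h1 : ∀ k ∈ Finset.range n, a * (n.succ : ℕ) / Real.pi * ((k + 1 : ℕ) : ℝ)⁻¹ - a ≤
      if h : k + 1 < n.succ then
        ‖inner ℂ (fourierVec n.succ e (⟨k + 1, h⟩ : Fin n.succ))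
          (T (fourierVec n.succ e (⟨k + 1, h⟩ : Fin n.succ)))‖ else 0 := by
    intro k hk
    have hk' : k + 1 < n.succ := by have := Finset.mem_range.1 hk; omega
    rw [dif_pos hk', inner_fourierVec_triangular hT (by simp) hk', norm_mul, Complex.norm_real,
      Real.norm_of_nonneg ha]
    set z := Complex.exp (2 * Real.pi * Complex.I / (n.succ : ℕ)) ^ (k + 1) with hz
    have hz1 : z ≠ 1 :=
      (Complex.isPrimitiveRoot_exp _ hN).pow_ne_one_of_pos_of_lt (by simp) hk'
    have hzp : 0 < ‖z - 1‖ := norm_pos_iff.2 (sub_ne_zero.2 hz1)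
    -- The chord is at most the arc; this makes `2 / ‖z - 1‖` at least `N / (π (k + 1))`, a multiple
    -- of a harmonic term.
    have h2 : ‖z - 1‖ ≤ 2 * Real.pi * (k + 1 : ℕ) / (n.succ : ℕ) := by
      have h3 : z = Complex.exp (Complex.I * ((2 * Real.pi * (k + 1 : ℕ) / (n.succ : ℕ) : ℝ) : ℂ)) := by
        rw [hz, ← Complex.exp_nat_mul]
        congr 1
        push_cast
        ring
      rw [h3]
      refine Real.norm_exp_I_mul_ofReal_sub_one_le.trans (le_of_eq ?_)
      rw [Real.norm_of_nonneg (by positivity)]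
    have h4 : 2 / ‖z - 1‖ - 1 ≤ ‖2 / (z - 1) + 1‖ := by
      have := norm_sub_le_norm_add (2 / (z - 1)) (1 : ℂ)
      simpa using this
    have h5 : (n.succ : ℕ) / Real.pi * ((k + 1 : ℕ) : ℝ)⁻¹ ≤ 2 / ‖z - 1‖ := by
      rw [le_div_iff₀ hzp]
      calc _ ≤ (n.succ : ℕ) / Real.pi * ((k + 1 : ℕ) : ℝ)⁻¹ *
            (2 * Real.pi * (k + 1 : ℕ) / (n.succ : ℕ)) := by gcongr
        _ = 2 := by
          have : ((k + 1 : ℕ) : ℝ) ≠ 0 := by positivity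
          field_simp
    calc _ = a * ((n.succ : ℕ) / Real.pi * ((k + 1 : ℕ) : ℝ)⁻¹ - 1) := by ring
      _ ≤ _ := mul_le_mul_of_nonneg_left (by linarith) ha
  have h6 : Real.log (n.succ : ℕ) ≤ ∑ k ∈ Finset.range n, ((k + 1 : ℕ) : ℝ)⁻¹ := by
    have := log_add_one_le_harmonic n
    simpa [harmonic] using this
  -- The term of frequency `0`, to which the diagonal formula does not apply, is just bounded below
  -- by `0`.
  refine le_trans ?_ (add_le_add (Finset.sum_le_sum h1) (c := 0) (by split_ifs <;> positivity))
  rw [Finset.sum_sub_distrib, ← Finset.mul_sum]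
  simp only [Finset.sum_const, Finset.card_range, nsmul_eq_mul, add_zero]
  have h7 : a * (n.succ : ℕ) / Real.pi * Real.log (n.succ : ℕ) ≤
      a * (n.succ : ℕ) / Real.pi * ∑ k ∈ Finset.range n, ((k + 1 : ℕ) : ℝ)⁻¹ := by gcongr
  have h8 : (n : ℝ) * a ≤ (n.succ : ℕ) * a := by
    gcongr
    omega
  calc _ = a * (n.succ : ℕ) / Real.pi * Real.log (n.succ : ℕ) - (n.succ : ℕ) * a := by ring
    _ ≤ _ := by linarith

end Fourier

/-! ### A unit vector with long constant blocks -/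

section SparseVector

variable {H : Type*} [NormedAddCommGroup H] [InnerProductSpace ℂ H]

/-- The lengths of the blocks of `exists_sparse_vector`. -/
def blockLength (k : ℕ) : ℕ := 2 ^ 8 ^ k

theorem blockLength_pos (k : ℕ) : 0 < blockLength k := pow_pos two_pos _

/-- The `k`-th block occupies the indices from `blockLength k` up to `2 * blockLength k`, excluded,
so this makes the blocks disjoint. -/
theorem two_mul_blockLength_le {k l : ℕ} (h : k < l) : 2 * blockLength k ≤ blockLength l := by
  unfold blockLength
  rw [← pow_succ']
  refine Nat.pow_le_pow_right two_pos ?_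
  exact Nat.pow_lt_pow_right (by norm_num) h

/-- The normalised sum of the basis vectors of the `k`-th block. -/
noncomputable def blockVec (b : HilbertBasis ℤ ℂ H) (k : ℕ) : H :=
  fourierVec (blockLength k) (fun j => b (blockLength k + j)) 0

theorem orthonormal_shift (b : HilbertBasis ℤ ℂ H) (p : ℤ) :
    Orthonormal ℂ (fun j : ℕ => b (p + j)) :=
  b.orthonormal.comp (fun j : ℕ => p + (j : ℤ)) fun i j h => by simpa using h

theorem norm_blockVec (b : HilbertBasis ℤ ℂ H) (k : ℕ) : ‖blockVec b k‖ = 1 :=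
  (orthonormal_fourierVec (N := blockLength k) (orthonormal_shift b (blockLength k))).1
    ⟨0, blockLength_pos k⟩

theorem inner_blockVec (b : HilbertBasis ℤ ℂ H) (n : ℤ) (k : ℕ) :
    inner ℂ (b n) (blockVec b k) =
      if (blockLength k : ℤ) ≤ n ∧ n < 2 * blockLength k
      then ((√(blockLength k : ℝ))⁻¹ : ℂ) else 0 := by
  have hb : ∀ m : ℤ, inner ℂ (b n) (b m) = if n = m then (1 : ℂ) else 0 :=
    fun m => orthonormal_iff_ite.1 b.orthonormal n m
  simp only [blockVec, fourierVec, pow_zero, one_pow, one_smul, inner_smul_right, inner_sum, hb]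
  split_ifs with h
  · obtain ⟨j, hj⟩ := Int.eq_ofNat_of_zero_le (sub_nonneg.2 h.1)
    rw [Finset.sum_eq_single_of_mem j (Finset.mem_range.2 (by omega)) fun i _ hi =>
      if_neg (by omega), if_pos (by omega), mul_one]
  · rw [Finset.sum_eq_zero, mul_zero]
    intro i hi
    rw [Finset.mem_range] at hi
    exact if_neg (by omega)

/-- A unit vector which is constant on blocks of length `N` at level `a`, with `a ^ 2 * N * log N`
unbounded. -/
theorem exists_sparse_vector [CompleteSpace H] (b : HilbertBasis ℤ ℂ H) :
    ∃ v : H, ‖v‖ = 1 ∧ inner ℂ (b 0) v = 0 ∧ ∀ C : ℝ, ∃ (N : ℕ) (p : ℤ) (a : ℝ), N ≠ 0 ∧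
      (∀ j < N, inner ℂ (b (p + j)) v = (a : ℂ)) ∧
      C < a ^ 2 * N * (Real.log N / Real.pi - 1) := by
  have hs : Summable fun k : ℕ => ((1 / 2 : ℝ) ^ k : ℂ) • blockVec b k := by
    refine Summable.of_norm ?_
    simp only [norm_smul, norm_blockVec, mul_one]
    refine (summable_geometric_of_lt_one (r := (1 / 2 : ℝ)) (by norm_num) (by norm_num)).congr
      fun k => ?_
    simp
  set u := ∑' k : ℕ, ((1 / 2 : ℝ) ^ k : ℂ) • blockVec b k with hu
  have hi : ∀ n, inner ℂ (b n) u = ∑' k : ℕ, ((1 / 2 : ℝ) ^ k : ℂ) * inner ℂ (b n) (blockVec b k) := by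
    intro n
    have := (innerSL ℂ (b n)).map_tsum hs
    rw [← hu] at this
    simpa [inner_smul_right] using this
  -- All blocks start at a positive index. This orthogonality later allows a reflection to exchange
  -- `b 0` and `v`.
  have h0 : inner ℂ (b 0) u = 0 := by
    rw [hi]
    refine (tsum_congr fun k => ?_).trans tsum_zero
    have := blockLength_pos k
    rw [inner_blockVec, if_neg (by omega), mul_zero]
  have hk : ∀ k, ∀ j < blockLength k, inner ℂ (b ((blockLength k : ℤ) + j)) u
      = (((1 / 2 : ℝ) ^ k * (√(blockLength k : ℝ))⁻¹ : ℝ) : ℂ) := by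
    intro k j hj
    rw [hi, tsum_eq_single k]
    · rw [inner_blockVec, if_pos (by omega)]
      push_cast
      rfl
    · intro l hl
      rw [inner_blockVec, if_neg, mul_zero]
      rcases lt_or_gt_of_ne hl with h | h
      · have := two_mul_blockLength_le h
        omega
      · have := two_mul_blockLength_le h
        omega
  have hu0 : u ≠ 0 := by
    intro h
    have := hk 0 0 (blockLength_pos 0)
    rw [h, inner_zero_right] at this
    have h2 : √(blockLength 0 : ℝ) ≠ 0 := by
      have := blockLength_pos 0
      positivity
    simp only [pow_zero, one_mul] at this
    exact inv_ne_zero h2 (by exact_mod_cast this.symm)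
  have hun : 0 < ‖u‖ := norm_pos_iff.2 hu0
  refine ⟨((‖u‖⁻¹ : ℝ) : ℂ) • u, ?_, ?_, fun C => ?_⟩
  · rw [norm_smul, Complex.norm_real, norm_inv, norm_norm, inv_mul_cancel₀ hun.ne']
  · rw [inner_smul_right, h0, mul_zero]
  · have hl : 0 < Real.log 2 / Real.pi := div_pos (Real.log_pos one_lt_two) Real.pi_pos
    -- The target quantity is `‖u‖⁻² (2 ^ k log 2 / π - 4⁻ᵏ)`, as `e2` shows; the added `1` absorbs
    -- `4⁻ᵏ`.
    obtain ⟨k, hkC⟩ := pow_unbounded_of_one_lt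
      ((‖u‖ ^ 2 * C + 1) / (Real.log 2 / Real.pi)) (one_lt_two (α := ℝ))
    rw [div_lt_iff₀ hl] at hkC
    refine ⟨blockLength k, blockLength k, ‖u‖⁻¹ * ((1 / 2 : ℝ) ^ k * (√(blockLength k : ℝ))⁻¹),
      (blockLength_pos k).ne', fun j hj => ?_, ?_⟩
    · rw [inner_smul_right, hk k j hj]
      push_cast
      rfl
    · have hb : (0 : ℝ) < blockLength k := by exact_mod_cast blockLength_pos k
      have hlog : Real.log (blockLength k) = 8 ^ k * Real.log 2 := by
        simp [blockLength, Real.log_pow]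
      -- The reason for the exponent `8 ^ k` in the block length: the logarithm of the length
      -- outgrows the loss `4⁻ᵏ` from the squared weights.
      have e1 : (1 / 2 : ℝ) ^ k * (1 / 2 : ℝ) ^ k * 8 ^ k = 2 ^ k := by
        rw [← mul_pow, ← mul_pow]
        norm_num
      have e2 : (‖u‖⁻¹ * ((1 / 2 : ℝ) ^ k * (√(blockLength k : ℝ))⁻¹)) ^ 2 * blockLength k *
          (Real.log (blockLength k) / Real.pi - 1) = (‖u‖ ^ 2)⁻¹ *
            (2 ^ k * (Real.log 2 / Real.pi) - (1 / 2 : ℝ) ^ k * (1 / 2 : ℝ) ^ k) := by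
        rw [hlog, ← e1]
        have : (√(blockLength k : ℝ))⁻¹ ^ 2 * blockLength k = 1 := by
          rw [inv_pow, Real.sq_sqrt hb.le, inv_mul_cancel₀ hb.ne']
        linear_combination ((‖u‖ ^ 2)⁻¹ * ((1 / 2 : ℝ) ^ k) ^ 2 *
          (8 ^ k * Real.log 2 / Real.pi - 1)) * this
      rw [e2, ← div_eq_inv_mul, lt_div_iff₀ (by positivity)]
      have e3 : (1 / 2 : ℝ) ^ k ≤ 1 := pow_le_one₀ (by norm_num) (by norm_num)
      have e4 : (0 : ℝ) ≤ (1 / 2 : ℝ) ^ k := by positivity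
      nlinarith

end SparseVector

/-! ### The derivative of multiplication in the left trivialization -/

namespace UnitaryManifold
section
variable {A : Type*} [CStarAlgebra A]

/-- The derivative of the multiplication, in the left trivialization of the tangent bundle given
by the Cayley charts. -/
theorem coe_mfderiv_mul (g h : unitary A) (X Y : SkewElt A) :
    ((show SkewElt A from mfderiv (𝓘(ℝ, SkewElt A).prod 𝓘(ℝ, SkewElt A)) 𝓘(ℝ, SkewElt A)
      (fun q : unitary A × unitary A => q.1 * q.2) (g, h)
        ((X, Y) : TangentSpace 𝓘(ℝ, SkewElt A) g × TangentSpace 𝓘(ℝ, SkewElt A) h) : SkewElt A) : A)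
      = star (h : A) * X * h + Y := by
  have hc : ∀ u : unitary A, MDifferentiableAt 𝓘(ℝ, SkewElt A) 𝓘(ℝ, A)
      (fun u : unitary A => (u : A)) u :=
    fun u => (contMDiff_coe (A := A)).mdifferentiableAt (by simp)
  have hm : MDifferentiableAt (𝓘(ℝ, SkewElt A).prod 𝓘(ℝ, SkewElt A)) 𝓘(ℝ, SkewElt A)
      (fun q : unitary A × unitary A => q.1 * q.2) (g, h) :=
    (contMDiff_mul 𝓘(ℝ, SkewElt A) ∞ (G := unitary A)).mdifferentiableAt (by simp)
  -- The map `(g, h) ↦ gh` into the algebra is differentiated twice: by the chain rule through the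
  -- group (`h1`) and by the product rule in the algebra (`h2`). Comparing and cancelling `gh` on
  -- the left gives the formula.
  have h1 := mfderiv_comp (I' := 𝓘(ℝ, SkewElt A)) (g, h) (hc (g * h)) hm
  have f1 := (hc g).hasMFDerivAt.comp (g, h)
    (hasMFDerivAt_fst (I := 𝓘(ℝ, SkewElt A)) (I' := 𝓘(ℝ, SkewElt A)) (x := (g, h)))
  have f2 := (hc h).hasMFDerivAt.comp (g, h)
    (hasMFDerivAt_snd (I := 𝓘(ℝ, SkewElt A)) (I' := 𝓘(ℝ, SkewElt A)) (x := (g, h)))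
  have h2 := (f1.mul' f2).mfderiv
  have h3 := (mfderiv_coe (g * h) (mfderiv (𝓘(ℝ, SkewElt A).prod 𝓘(ℝ, SkewElt A)) 𝓘(ℝ, SkewElt A)
      (fun q : unitary A × unitary A => q.1 * q.2) (g, h)
        ((X, Y) : TangentSpace 𝓘(ℝ, SkewElt A) g × TangentSpace 𝓘(ℝ, SkewElt A) h)))
  have h4 : ((g * h : unitary A) : A) * ((show SkewElt A from
      mfderiv (𝓘(ℝ, SkewElt A).prod 𝓘(ℝ, SkewElt A)) 𝓘(ℝ, SkewElt A)
      (fun q : unitary A × unitary A => q.1 * q.2) (g, h)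
        ((X, Y) : TangentSpace 𝓘(ℝ, SkewElt A) g × TangentSpace 𝓘(ℝ, SkewElt A) h) : SkewElt A) : A)
      = g * (h * Y) + g * X * h := by
    refine h3.symm.trans ?_
    refine (DFunLike.congr_fun h1 _).symm.trans ((DFunLike.congr_fun h2 _).trans ?_)
    exact congrArg₂ (fun x y : A => (g : A) * x + y * h) (mfderiv_coe h Y) (mfderiv_coe g X)
  have h5 := congrArg (fun x => star ((g * h : unitary A) : A) * x) h4
  simp only [← mul_assoc, Unitary.coe_star_mul_self, one_mul] at h5
  refine h5.trans ?_
  rw [mul_add]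
  simp only [← mul_assoc, Submonoid.coe_mul, star_mul]
  rw [mul_assoc (star (h : A)), Unitary.coe_star_mul_self, mul_one, Unitary.coe_star_mul_self,
    one_mul, add_comm]
end
end UnitaryManifold

/-! ### Coadjoint invariance of the fiber at the identity -/

namespace PoissonLieStructure
open UnitaryManifold
section
variable {A : Type*} [CStarAlgebra A]
    {F : Type*} [NormedAddCommGroup F] [NormedSpace ℝ F] [CompleteSpace F]
    {V : unitary A → Type*}
    [∀ g, AddCommGroup (V g)] [∀ g, Module ℝ (V g)] [∀ g, TopologicalSpace (V g)]
    [∀ g, IsTopologicalAddGroup (V g)] [∀ g, ContinuousSMul ℝ (V g)]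
    [TopologicalSpace (TotalSpace F V)] [FiberBundle F V] [VectorBundle ℝ F V]
    [ContMDiffVectorBundle ∞ F V 𝓘(ℝ, SkewElt A)]

/-- The transpose of a right translation preserves the bundle. -/
theorem exists_pairing_right_translation (P : PoissonLieStructure (SkewElt A) (unitary A) F V)
    {g h k : unitary A} (hk : g * h = k) (α : V k) :
    ∃ α' : V g, ∀ X Z : SkewElt A, (Z : A) = star (h : A) * X * h →
      P.pairing g α' X = P.pairing k α Z := by
  subst hk
  obtain ⟨S, hS, -⟩ := P.isPoisson_mul g h
  refine ⟨(S α).1, fun X Z hZ => ?_⟩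
  -- Freezing the second factor turns multiplication into right translation by `h`, which in the
  -- left trivialization acts by `X ↦ h* X h`.
  have h1 := hS α ((X, 0) : SkewElt A × SkewElt A)
  have h2 : (mfderiv (𝓘(ℝ, SkewElt A).prod 𝓘(ℝ, SkewElt A)) 𝓘(ℝ, SkewElt A)
      (fun q : unitary A × unitary A => q.1 * q.2) (g, h)
        ((X, 0) : SkewElt A × SkewElt A) : SkewElt A) = Z :=
    Subtype.ext ((coe_mfderiv_mul g h X 0).trans (by rw [hZ]; simp))
  have h3 : P.pairing g (S α).1 X + P.pairing h (S α).2 (0 : SkewElt A) = P.pairing (g * h) α Z :=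
    h1.trans (congrArg (fun W : SkewElt A => P.pairing (g * h) α W) h2)
  have h4 : P.pairing h (S α).2 (0 : SkewElt A) = 0 := map_zero (P.pairing h (S α).2)
  rwa [h4, add_zero] at h3

/-- The transpose of a left translation preserves the bundle. -/
theorem exists_pairing_left_translation (P : PoissonLieStructure (SkewElt A) (unitary A) F V)
    {g h k : unitary A} (hk : g * h = k) (α : V k) :
    ∃ α' : V h, ∀ X : SkewElt A, P.pairing h α' X = P.pairing k α X := by
  subst hk
  obtain ⟨S, hS, -⟩ := P.isPoisson_mul g h
  refine ⟨(S α).2, fun X => ?_⟩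
  have h1 := hS α ((0, X) : SkewElt A × SkewElt A)
  have h2 : (mfderiv (𝓘(ℝ, SkewElt A).prod 𝓘(ℝ, SkewElt A)) 𝓘(ℝ, SkewElt A)
      (fun q : unitary A × unitary A => q.1 * q.2) (g, h)
        ((0, X) : SkewElt A × SkewElt A) : SkewElt A) = X :=
    Subtype.ext ((coe_mfderiv_mul g h 0 X).trans (by simp))
  have h3 : P.pairing g (S α).1 (0 : SkewElt A) + P.pairing h (S α).2 X = P.pairing (g * h) α X :=
    h1.trans (congrArg (fun W : SkewElt A => P.pairing (g * h) α W) h2)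
  have h4 : P.pairing g (S α).1 (0 : SkewElt A) = 0 := map_zero (P.pairing g (S α).1)
  rwa [h4, zero_add] at h3

/-- The fiber at the identity is invariant under the coadjoint action. -/
theorem exists_pairing_coadjoint (P : PoissonLieStructure (SkewElt A) (unitary A) F V)
    (g : unitary A) (α : V 1) :
    ∃ α' : V 1, ∀ X Z : SkewElt A, (Z : A) = g * X * star (g : A) →
      P.pairing 1 α' X = P.pairing 1 α Z := by
  -- Conjugation by `g` is factored as left translation `1 ↦ g` followed by right translation `g ↦ g
  -- g⁻¹ = 1`. Transposes run backwards, so `α` moves from the fiber at `1` to the fiber at `g` and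
  -- then back to `1`.
  obtain ⟨α₁, h₁⟩ := P.exists_pairing_right_translation (mul_inv_cancel g) α
  obtain ⟨α₂, h₂⟩ := P.exists_pairing_left_translation (mul_one g) α₁
  refine ⟨α₂, fun X Z hZ => (h₂ X).trans (h₁ X Z ?_)⟩
  rw [hZ, ← Unitary.star_eq_inv, Unitary.coe_star, star_star]

end
end PoissonLieStructure

/-! ### Rank-one test operators and the triangular truncation -/

section RankOne

open InnerProductSpace

variable {H : Type*} [NormedAddCommGroup H] [InnerProductSpace ℂ H]

theorem operatorTrace_mul_rankOne (b : HilbertBasis ℤ ℂ H) (x y : H) (T : H →L[ℂ] H) :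
    operatorTrace b (T * rankOne ℂ x y) = inner ℂ y (T x) := by
  refine HasSum.tsum_eq ?_
  refine (congrArg (fun f : ℤ → ℂ => HasSum f _) (funext fun n => ?_)).mpr
    (b.hasSum_inner_mul_inner y (T x))
  rw [mul_apply_eq_comp, rankOne_apply, map_smul, inner_smul_right]

variable [CompleteSpace H]

/-- Parseval for `T* y` and `x`. The `HasSum` form allows two such traces to be subtracted, and also
supplies the summability that makes a rank-one projection trace class. -/
theorem hasSum_inner_rankOne_mul (b : HilbertBasis ℤ ℂ H) (x y : H) (T : H →L[ℂ] H) :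
    HasSum (fun n => inner ℂ (b n) ((rankOne ℂ x y * T) (b n))) (inner ℂ y (T x)) := by
  have h := b.hasSum_inner_mul_inner (ContinuousLinearMap.adjoint T y) x
  rw [ContinuousLinearMap.adjoint_inner_left] at h
  refine (congrArg (fun f : ℤ → ℂ => HasSum f _) (funext fun n => ?_)).mpr h
  rw [mul_apply_eq_comp, rankOne_apply, inner_smul_right,
    ContinuousLinearMap.adjoint_inner_left]

theorem star_rankOne (x y : H) : star (rankOne ℂ x y : H →L[ℂ] H) = rankOne ℂ y x := by
  rw [ContinuousLinearMap.star_eq_adjoint, adjoint_rankOne]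

/-- The chart identifies tangent vectors by left translation, which at the identity is trivial. -/
theorem imTracePairing_apply (b : HilbertBasis ℤ ℂ H) (B : H →L[ℂ] H) (X : SkewElt (H →L[ℂ] H)) :
    imTracePairing b B X = (operatorTrace b ((X : H →L[ℂ] H) * B)).im := by
  refine congrArg (fun A : H →L[ℂ] H => (operatorTrace b (A * B)).im) ?_
  exact (UnitaryManifold.mfderiv_coe 1 X).trans (one_mul (X : H →L[ℂ] H))

theorem rankOne_mem_upperTriangularTraceClass (b : HilbertBasis ℤ ℂ H) (k : ℤ) :
    rankOne ℂ (b k) (b k) ∈ upperTriangularTraceClass b := by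
  constructor
  · have h0 : 0 ≤ rankOne ℂ (b k) (b k) :=
      (ContinuousLinearMap.nonneg_iff_isPositive _).2 (isPositive_rankOne_self (b k))
    unfold IsTraceClass
    rw [CFC.abs_of_nonneg _ h0]
    have := (hasSum_inner_rankOne_mul b (b k) (b k) 1).mapL Complex.reCLM
    rw [mul_one] at this
    exact this.summable
  · intro n
    have hb : inner ℂ (b k) (b n) = if k = n then (1 : ℂ) else 0 :=
      orthonormal_iff_ite.1 b.orthonormal k n
    rw [rankOne_apply, hb]
    split_ifs with h
    · subst h
      rw [one_smul, inner_self_eq_norm_sq_to_K]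
      refine ⟨subset_closure (Submodule.subset_span ⟨k, Set.mem_Ici.2 le_rfl, rfl⟩), ?_⟩
      norm_cast
    · simp

theorem inner_eq_zero_of_mem_upperTriangularTraceClass {b : HilbertBasis ℤ ℂ H} {T : H →L[ℂ] H}
    (hT : T ∈ upperTriangularTraceClass b) {m n : ℤ} (h : m < n) : inner ℂ (b m) (T (b n)) = 0 := by
  have hle : (Submodule.span ℂ (b '' Set.Ici n)).topologicalClosure ≤ (ℂ ∙ b m)ᗮ := by
    refine Submodule.topologicalClosure_minimal _ (Submodule.span_le.2 ?_)
      (Submodule.isClosed_orthogonal _)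
    rintro _ ⟨k, hk, rfl⟩
    rw [SetLike.mem_coe, Submodule.mem_orthogonal_singleton_iff_inner_right]
    exact b.orthonormal.2 (h.trans_le hk).ne
  exact Submodule.mem_orthogonal_singleton_iff_inner_right.1 (hle (hT.2 n).1)

/-- A self-adjoint unitary exchanging two orthogonal unit vectors. -/
theorem exists_unitary_star_apply {u v : H} (hu : ‖u‖ = 1) (hv : ‖v‖ = 1) (huv : inner ℂ u v = 0) :
    ∃ g : unitary (H →L[ℂ] H), star (g : H →L[ℂ] H) u = v := by
  have hvu : inner ℂ v u = 0 := inner_eq_zero_symm.1 huv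
  -- The unitary is the reflection `1 - 2 w w* / ‖w‖²` in `w = v - u`; orthogonality gives `‖w‖² =
  -- 2`, so it is `1 - R`.
  set R : H →L[ℂ] H := rankOne ℂ (v - u) (v - u) with hR
  have hs : star (1 - R) = 1 - R := by rw [star_sub, star_one, hR, star_rankOne]
  have hww : inner ℂ (v - u) (v - u) = (2 : ℂ) := by
    rw [inner_sub_left, inner_sub_right, inner_sub_right, huv, hvu, inner_self_eq_norm_sq_to_K,
      inner_self_eq_norm_sq_to_K, hu, hv]
    norm_num
  have hRR : R * R = (2 : ℂ) • R := by
    ext x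
    simp only [hR, mul_apply_eq_comp, rankOne_apply, inner_smul_right, hww,
      smul_apply, smul_smul]
    rw [mul_comm]
  have h1 : (1 - R) * (1 - R) = 1 := by
    rw [sub_mul, mul_sub, mul_sub, hRR, two_smul]
    simp
  refine ⟨⟨1 - R, Unitary.mem_iff.2 ⟨by rw [hs, h1], by rw [hs, h1]⟩⟩, ?_⟩
  change star (1 - R) u = v
  have hwu : inner ℂ (v - u) u = (-1 : ℂ) := by
    rw [inner_sub_left, hvu, inner_self_eq_norm_sq_to_K, hu]
    simp
  rw [hs, sub_apply, hR, rankOne_apply, hwu]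
  simp

/-- Testing an equality of pairings with rank two skew-adjoint operators. -/
theorem im_inner_eq_of_pairing_eq {b : HilbertBasis ℤ ℂ H} {B : H →L[ℂ] H} {v : H}
    (h : ∀ X : SkewElt (H →L[ℂ] H), (operatorTrace b ((X : H →L[ℂ] H) * B)).im
      = (inner ℂ v ((X : H →L[ℂ] H) v)).im) (c : ℂ) (m n : ℤ) :
    (c * inner ℂ (b n) (B (b m)) - (starRingEnd ℂ) c * inner ℂ (b m) (B (b n))).im =
      (c * (inner ℂ v (b m) * inner ℂ (b n) v) -
        (starRingEnd ℂ) c * (inner ℂ v (b n) * inner ℂ (b m) v)).im := by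
  set Y : H →L[ℂ] H :=
    c • rankOne ℂ (b m) (b n) - (starRingEnd ℂ) c • rankOne ℂ (b n) (b m) with hY
  have hs : star Y = -Y := by
    rw [hY, star_sub, star_smul, star_smul, star_rankOne, star_rankOne]
    simp
  have h1 := h ⟨Y, hs⟩
  have h2 : operatorTrace b (Y * B)
      = c * inner ℂ (b n) (B (b m)) - (starRingEnd ℂ) c * inner ℂ (b m) (B (b n)) := by
    refine HasSum.tsum_eq ?_
    refine (congrArg (fun f : ℤ → ℂ => HasSum f _) (funext fun k => ?_)).mpr
      (((hasSum_inner_rankOne_mul b (b m) (b n) B).mul_left c).sub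
      ((hasSum_inner_rankOne_mul b (b n) (b m) B).mul_left ((starRingEnd ℂ) c)))
    simp only [hY, mul_apply_eq_comp, sub_apply,
      smul_apply, inner_sub_right, inner_smul_right]
  have h3 : inner ℂ v (Y v) = c * (inner ℂ v (b m) * inner ℂ (b n) v) -
        (starRingEnd ℂ) c * (inner ℂ v (b n) * inner ℂ (b m) v) := by
    simp only [hY, rankOne_apply, sub_apply,
      smul_apply, inner_sub_right, inner_smul_right]
    ring
  rwa [h2, h3] at h1

/-- The triangular truncation of the rank one projection onto `v`. -/
theorem inner_eq_of_pairing_eq {b : HilbertBasis ℤ ℂ H} {B : H →L[ℂ] H} {v : H}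
    (hB : B ∈ upperTriangularTraceClass b)
    (h : ∀ X : SkewElt (H →L[ℂ] H), (operatorTrace b ((X : H →L[ℂ] H) * B)).im
      = (inner ℂ v ((X : H →L[ℂ] H) v)).im) {m n : ℤ} {a : ℝ}
    (hm : inner ℂ (b m) v = (a : ℂ)) (hn : inner ℂ (b n) v = (a : ℂ)) :
    inner ℂ (b n) (B (b m)) =
      if m < n then 2 * ((a ^ 2 : ℝ) : ℂ) else if m = n then ((a ^ 2 : ℝ) : ℂ) else 0 := by
  have hm' : inner ℂ v (b m) = (a : ℂ) := by rw [← inner_conj_symm, hm, Complex.conj_ofReal]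
  have hn' : inner ℂ v (b n) = (a : ℂ) := by rw [← inner_conj_symm, hn, Complex.conj_ofReal]
  -- The choices `c = 1` and `c = i` give the imaginary part of the difference and the real part of
  -- the sum of the two mirror entries of `B`. Off the diagonal one of these entries vanishes, which
  -- doubles the other. On the diagonal the tests see only the real part, and the reality condition
  -- in `b_1^+(H)` supplies the rest.
  have h1 := im_inner_eq_of_pairing_eq h 1 m n
  have h2 := im_inner_eq_of_pairing_eq h Complex.I m n
  rw [hm, hn, hm', hn'] at h1 h2
  split_ifs with hlt heq
  · rw [inner_eq_zero_of_mem_upperTriangularTraceClass hB hlt] at h1 h2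
    apply Complex.ext
    · simp [pow_two] at h2 ⊢
      linarith
    · simpa [pow_two] using h1
  · subst heq
    have h3 := (hB.2 m).2
    apply Complex.ext
    · simp [pow_two] at h2 ⊢
      linarith
    · rw [h3]
      simp [pow_two]
  · exact inner_eq_zero_of_mem_upperTriangularTraceClass hB (by omega)

end RankOne

/-! ### The contradiction -/

theorem corollary3p3 {H : Type*} [NormedAddCommGroup H] [InnerProductSpace ℂ H] [CompleteSpace H]
    (b : HilbertBasis ℤ ℂ H)
    {F : Type*} [NormedAddCommGroup F] [NormedSpace ℝ F] [CompleteSpace F]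
    {V : unitary (H →L[ℂ] H) → Type*}
    [∀ g, AddCommGroup (V g)] [∀ g, Module ℝ (V g)] [∀ g, TopologicalSpace (V g)]
    [∀ g, IsTopologicalAddGroup (V g)] [∀ g, ContinuousSMul ℝ (V g)]
    [TopologicalSpace (TotalSpace F V)] [FiberBundle F V] [VectorBundle ℝ F V]
    [ContMDiffVectorBundle ∞ F V 𝓘(ℝ, SkewElt (H →L[ℂ] H))] :
    ¬ ∃ P : PoissonLieStructure (SkewElt (H →L[ℂ] H)) (unitary (H →L[ℂ] H)) F V,
      Set.range (P.pairing 1) = dualImage b := by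
  rintro ⟨P, hP⟩
  obtain ⟨v, hv1, hv0, hvC⟩ := exists_sparse_vector b
  obtain ⟨g, hg⟩ := exists_unitary_star_apply (b.orthonormal.1 0) hv1 hv0
  -- The functional `A ↦ Im ⟨b 0, A (b 0)⟩`, represented by the projection onto `b 0`.
  let l : SkewElt (H →L[ℂ] H) →L[ℝ] ℝ :=
    Complex.imCLM ∘L ((innerSL ℂ (b 0) ∘L ContinuousLinearMap.apply ℂ H (b 0)).restrictScalars ℝ) ∘L
      (SkewElt (H →L[ℂ] H)).subtypeL
  have hl : l ∈ dualImage b := by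
    refine ⟨_, rankOne_mem_upperTriangularTraceClass b 0, fun X => ?_⟩
    refine Eq.trans ?_ (imTracePairing_apply b _ X).symm
    rw [operatorTrace_mul_rankOne]
    rfl
  rw [← hP] at hl
  obtain ⟨α, hα⟩ := hl
  obtain ⟨α', hα'⟩ := P.exists_pairing_coadjoint g α
  obtain ⟨B, hB, hBX⟩ : P.pairing 1 α' ∈ dualImage b := hP ▸ Set.mem_range_self α'
  -- The coadjoint translate of `l` is again represented in `b_1^+(H)`; since `g* (b 0) = v`, it is
  -- the functional of the projection onto `v`.
  have key : ∀ X : SkewElt (H →L[ℂ] H), (operatorTrace b ((X : H →L[ℂ] H) * B)).im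
      = (inner ℂ v ((X : H →L[ℂ] H) v)).im := by
    intro X
    have hs : star (X : H →L[ℂ] H) = -(X : H →L[ℂ] H) := X.2
    let Z : SkewElt (H →L[ℂ] H) := ⟨g * X * star (g : H →L[ℂ] H), by
      change star _ = - _
      simp [hs, mul_assoc]⟩
    rw [← imTracePairing_apply]
    refine (hBX X).symm.trans ((hα' X Z rfl).trans ?_)
    rw [hα]
    change (inner ℂ (b 0) ((g : H →L[ℂ] H) ((X : H →L[ℂ] H) (star (g : H →L[ℂ] H) (b 0))))).im = _
    rw [← ContinuousLinearMap.adjoint_inner_left, ← ContinuousLinearMap.star_eq_adjoint, hg]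
  obtain ⟨τ, hτ⟩ := hB.1.exists_sum_norm_inner_le
  obtain ⟨N, p, a, hN, ha, hlt⟩ := hvC τ
  have hT : ∀ i < N, ∀ j < N, inner ℂ (b (p + i)) (B (b (p + j))) =
      if j < i then 2 * ((a ^ 2 : ℝ) : ℂ) else if j = i then ((a ^ 2 : ℝ) : ℂ) else 0 := by
    intro i hi j hj
    rw [inner_eq_of_pairing_eq hB key (ha j hj) (ha i hi)]
    simp
  have h1 := le_sum_norm_inner_fourierVec hN (e := fun j : ℕ => b (p + j)) (sq_nonneg a) hT
  have h2 := hτ (Fin N) _ (orthonormal_fourierVec (orthonormal_shift b p))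
  linarith
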